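/- Let $\Lambda$ be an associative unital ring, let $\mathrm{Mod}(\Lambda)$ be the category of right $\Lambda$-modules, $\mathrm{mod}(\Lambda)$ its full subcategory of finitely presented modules, and let $(\mathrm{mod}(\Lambda),\mathrm{Ab})$ be the category of additive functors $\mathrm{mod}(\Lambda)\to\mathrm{Ab}$ and natural transformations. An injective copresentation of $F\in(\mathrm{mod}(\Lambda),\mathrm{Ab})$ is an exact sequence $0\to F\to -\otimes_\Lambda M\to -\otimes_\Lambda N$ of functors on $\mathrm{mod}(\Lambda)$, where $M,N$ are left $\Lambda$-modules such that $-\otimes_\Lambda M$ and $-\otimes_\Lambda N$ are injective objects of $(\mathrm{mod}(\Lambda),\mathrm{Ab})$, and the second arrow is $-\otimes_\Lambda f$ for a homomorphism $f:M\to N$. The colimit extension $\overrightarrow{F}:\mathrm{Mod}(\Lambda)\to\mathrm{Ab}$ of $F$ is the kernel of $-\otimes_\Lambda f:-\otimes_\Lambda M\to-\otimes_\Lambda N$ on $\mathrm{Mod}(\Lambda)$. Theorem. (1) Every additive functor $F:\mathrm{mod}(\Lambda)\to\mathrm{Ab}$ has an injective copresentation, hence a colimit extension. (2) Every colimit extension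 $\overrightarrow{F}$ of $F$ (for any choice of injective copresentation) is additive, commutes with filtered colimits, and its restriction to $\mathrm{mod}(\Lambda)$ is isomorphic to $F$; every functor $G:\mathrm{Mod}(\Lambda)\to\mathrm{Ab}$ which commutes with filtered colimits and whose restriction to $\mathrm{mod}(\Lambda)$ is isomorphic to $F$ is isomorphic to $\overrightarrow{F}$. (3) For any choice of injective copresentations, colimit extension is the object part of a functor from $(\mathrm{mod}(\Lambda),\mathrm{Ab})$ to the category of additive functors $\mathrm{Mod}(\Lambda)\to\mathrm{Ab}$ which commute with filtered colimits, and this functor is an equivalence with quasi-inverse the restriction to $\mathrm{mod}(\Lambda)$; the natural isomorphism between $F$ and the restriction of $\overrightarrow{F}$ can be taken to be the canonical one, that is, the one compatible with the embeddings of both in $-\otimes_\Lambda M$. -/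

import Mathlib

open CategoryTheory CategoryTheory.Limits
open scoped TensorProduct

universe u

noncomputable section

namespace ColimExt

/-! ### The tensor product of a right module and a left module over an arbitrary ring.
Right `Λ`-modules are modules over `Λᵐᵒᵖ`, so that `a * r` is `MulOpposite.op r • a`. -/

section Tensor

variable (Λ : Type u) [Ring Λ]

/-- The subgroup of `A ⊗[ℤ] M` generated by all `(a * r) ⊗ m - a ⊗ (r * m)`. -/
def balancing (A M : Type u) [AddCommGroup A] [Module Λᵐᵒᵖ A] [AddCommGroup M] [Module Λ M] :
    AddSubgroup (A ⊗[ℤ] M) :=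
  AddSubgroup.closure {t | ∃ (a : A) (r : Λ) (m : M),
    t = (MulOpposite.op r • a) ⊗ₜ[ℤ] m - a ⊗ₜ[ℤ] (r • m)}

/-- The abelian group `A ⊗_Λ M`. -/
abbrev Tens (A M : Type u) [AddCommGroup A] [Module Λᵐᵒᵖ A] [AddCommGroup M] [Module Λ M] :
    Type u :=
  (A ⊗[ℤ] M) ⧸ balancing Λ A M

variable {Λ}

/-- The element `a ⊗ m` of `A ⊗_Λ M`. -/
def Tens.mk {A M : Type u} [AddCommGroup A] [Module Λᵐᵒᵖ A] [AddCommGroup M] [Module Λ M]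
    (a : A) (m : M) : Tens Λ A M :=
  QuotientAddGroup.mk' (balancing Λ A M) (a ⊗ₜ[ℤ] m)

/-- The homomorphism `g ⊗ f : A ⊗_Λ M → B ⊗_Λ N`. -/
def Tens.map {A B M N : Type u} [AddCommGroup A] [Module Λᵐᵒᵖ A] [AddCommGroup B] [Module Λᵐᵒᵖ B]
    [AddCommGroup M] [Module Λ M] [AddCommGroup N] [Module Λ N]
    (g : A →ₗ[Λᵐᵒᵖ] B) (f : M →ₗ[Λ] N) : Tens Λ A M →+ Tens Λ B N :=
  QuotientAddGroup.map _ _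
    (TensorProduct.map g.toAddMonoidHom.toIntLinearMap
      f.toAddMonoidHom.toIntLinearMap).toAddMonoidHom (by
      rw [balancing, AddSubgroup.closure_le]
      rintro _ ⟨a, r, m, rfl⟩
      refine AddSubgroup.subset_closure ⟨g a, r, f m, ?_⟩
      refine (map_sub _ _ _).trans (congrArg₂ (· - ·) ?_ ?_)
      · exact congrArg (· ⊗ₜ[ℤ] f m) (g.map_smul (MulOpposite.op r) a)
      · exact congrArg (g a ⊗ₜ[ℤ] ·) (f.map_smul r m))

theorem Tens.map_mk {A B M N : Type u} [AddCommGroup A] [Module Λᵐᵒᵖ A] [AddCommGroup B]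
    [Module Λᵐᵒᵖ B] [AddCommGroup M] [Module Λ M] [AddCommGroup N] [Module Λ N]
    (g : A →ₗ[Λᵐᵒᵖ] B) (f : M →ₗ[Λ] N) (a : A) (m : M) :
    Tens.map g f (Tens.mk a m) = Tens.mk (g a) (f m) :=
  rfl

theorem Tens.add_mk {A M : Type u} [AddCommGroup A] [Module Λᵐᵒᵖ A] [AddCommGroup M] [Module Λ M]
    (a b : A) (m : M) : (Tens.mk (a + b) m : Tens Λ A M) = Tens.mk a m + Tens.mk b m := by
  rw [Tens.mk, TensorProduct.add_tmul, map_add]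
  rfl

theorem Tens.hom_ext {A M : Type u} [AddCommGroup A] [Module Λᵐᵒᵖ A] [AddCommGroup M] [Module Λ M]
    {X : Type u} [AddCommGroup X] {φ ψ : Tens Λ A M →+ X}
    (h : ∀ (a : A) (m : M), φ (Tens.mk a m) = ψ (Tens.mk a m)) : φ = ψ := by
  refine QuotientAddGroup.addMonoidHom_ext _ (AddMonoidHom.ext fun t => ?_)
  induction t with
  | zero => rw [map_zero, map_zero]
  | tmul a m => exact h a m
  | add s t hs ht => rw [map_add, map_add, hs, ht]

end Tensor

variable {Λ : Type u} [Ring Λ]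

/-- The functor `- ⊗_Λ M` from right `Λ`-modules to abelian groups. -/
def tensorFunctor (M : ModuleCat.{u} Λ) : ModuleCat.{u} Λᵐᵒᵖ ⥤ AddCommGrpCat.{u} where
  obj A := AddCommGrpCat.of (Tens Λ A M)
  map g := AddCommGrpCat.ofHom (Tens.map g.hom (LinearMap.id : M →ₗ[Λ] M))
  map_id A := by
    apply AddCommGrpCat.hom_ext
    exact Tens.hom_ext fun _ _ => rfl
  map_comp g h := by
    apply AddCommGrpCat.hom_ext
    exact Tens.hom_ext fun _ _ => rfl

/-- The natural transformation `- ⊗_Λ f` for a homomorphism `f : M → N` of left modules. -/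
def tensorMap {M N : ModuleCat.{u} Λ} (f : M ⟶ N) : tensorFunctor M ⟶ tensorFunctor N where
  app A := AddCommGrpCat.ofHom (Tens.map (LinearMap.id : A →ₗ[Λᵐᵒᵖ] A) f.hom)
  naturality A B g := by
    apply AddCommGrpCat.hom_ext
    exact Tens.hom_ext fun _ _ => rfl

instance tensorFunctor_additive (M : ModuleCat.{u} Λ) : (tensorFunctor M).Additive where
  map_add {A B g h} := by
    apply AddCommGrpCat.hom_ext
    exact Tens.hom_ext fun a m => Tens.add_mk (g.hom a) (h.hom a) m

/-! ### Functors on finitely presented modules -/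

variable (Λ)

/-- The property of a right `Λ`-module of being finitely presented. -/
def isFP : ObjectProperty (ModuleCat.{u} Λᵐᵒᵖ) :=
  fun A => Module.FinitePresentation Λᵐᵒᵖ A

/-- The category `mod Λ` of finitely presented right `Λ`-modules. -/
abbrev FPMod : Type (u + 1) := (isFP Λ).FullSubcategory

/-- The inclusion of `mod Λ` in `Mod Λ`. -/
abbrev fpIncl : FPMod Λ ⥤ ModuleCat.{u} Λᵐᵒᵖ := (isFP Λ).ι

/-- The category `(mod Λ, Ab)` of additive functors `mod Λ ⥤ Ab`. -/
abbrev SmallFunctorCat := AdditiveFunctor (FPMod Λ) AddCommGrpCat.{u}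

/-- The property of a functor `Mod Λ ⥤ Ab` of being additive and commuting with filtered
colimits. -/
def isFinitary : ObjectProperty (ModuleCat.{u} Λᵐᵒᵖ ⥤ AddCommGrpCat.{u}) :=
  fun G => G.Additive ∧ PreservesFilteredColimitsOfSize.{u, u} G

/-- The category of additive functors `Mod Λ ⥤ Ab` which commute with filtered colimits. -/
abbrev FinitaryFunctorCat := (isFinitary Λ).FullSubcategory

/-- Restriction of functors to finitely presented modules. -/
def restriction : FinitaryFunctorCat Λ ⥤ SmallFunctorCat Λ :=
  ObjectProperty.lift _
    ((isFinitary Λ).ι ⋙ (Functor.whiskeringLeft _ _ _).obj (fpIncl Λ))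
    (fun G => by
      have := G.property.1
      exact inferInstanceAs (fpIncl Λ ⋙ G.obj).Additive)

variable {Λ}

/-- The functor `- ⊗_Λ M` on finitely presented right modules. -/
def fpTensor (M : ModuleCat.{u} Λ) : SmallFunctorCat Λ :=
  AdditiveFunctor.of (fpIncl Λ ⋙ tensorFunctor M)

/-- An injective copresentation `0 ⟶ F ⟶ - ⊗ M ⟶ - ⊗ N` of `F` in `(mod Λ, Ab)`; the second
arrow is of the form `- ⊗ f`, and exactness is exactness at each finitely presented module. -/
structure InjectiveCopresentation (F : SmallFunctorCat Λ) where
  /-- the first left module -/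
  M : ModuleCat.{u} Λ
  /-- the second left module -/
  N : ModuleCat.{u} Λ
  injective_M : Injective (fpTensor M)
  injective_N : Injective (fpTensor N)
  /-- the embedding of `F` -/
  ι : F.obj ⟶ fpIncl Λ ⋙ tensorFunctor M
  /-- the homomorphism which induces the second arrow -/
  f : M ⟶ N
  injective_ι : ∀ A : FPMod Λ, Function.Injective (ι.app A)
  exact : ∀ A : FPMod Λ, Function.Exact (ι.app A) ((tensorMap f).app A.obj)

namespace InjectiveCopresentation

variable {F : SmallFunctorCat Λ} (c : InjectiveCopresentation F)

/-- The colimit extension of `F` computed from the injective copresentation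
`0 ⟶ F ⟶ - ⊗ M ⟶ - ⊗ N`: the kernel of `- ⊗ M ⟶ - ⊗ N` on the category of all modules. -/
def colimitExtension : ModuleCat.{u} Λᵐᵒᵖ ⥤ AddCommGrpCat.{u} :=
  kernel (tensorMap c.f)

/-- The inclusion of the colimit extension in `- ⊗ M`. -/
def incl : c.colimitExtension ⟶ tensorFunctor c.M :=
  kernel.ι (tensorMap c.f)

end InjectiveCopresentation

end ColimExt

end

/-!
Write `T_M` for `- ⊗_Λ M`, on all right modules or on the finitely presented ones.

*Copresentations.* For a family `A` of finitely presented modules let `D_A` be the functor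
`X ↦ ∏ i, Hom_ℤ(Hom_Λ(X, A i), ℚ/ℤ)`. By the Yoneda lemma, a natural transformation from an
additive functor `F` on finitely presented modules to `D_A` is a family of characters of the groups
`F (A i)` (`exists_eq_ofCharacters`). Since characters extend along injections, `D_A` is injective;
since characters separate points, `F` embeds in `D_A` when `A` runs through all finitely presented
modules up to isomorphism, each repeated once for every character. On finitely presented modules,
the pairing `x ⊗ φ ↦ (h ↦ φ (h x))` identifies `D_A` with `T_M`, where
`M = ∏ i, Hom_ℤ(A i, ℚ/ℤ)` (`injective_pairing_app`, `surjective_pairing_app`). Embedding the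
cokernel of `F ⟶ T_M` in the same way gives `T_M ⟶ T_N`, which comes from a homomorphism `M ⟶ N`
because a natural transformation between tensor functors is determined by its component at `Λ`
(`exists_eq_tensorMap`).

*Finitary functors.* The functor `T_M` is a left adjoint, so it commutes with filtered colimits, and
the kernel of `T_M ⟶ T_N` does so as well, because filtered colimits of abelian groups are exact
(`preservesFilteredColimits_kernel`). Finitely presented modules are the closure of the
finitely presentable strong generator `Λ` under finite colimits
(`isFP_eq_colimitsCardinalClosure`), so every module is canonically a filtered colimit of finitely
presented ones. Hence a functor which commutes with filtered colimits is the left Kan extension of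
its restriction to finitely presented modules, and restriction is fully faithful
(`bijective_whiskerLeft_fpIncl`).

*Equivalence.* Both `F` and the restriction of its colimit extension are the kernel of
`T_M ⟶ T_N` on finitely presented modules, hence canonically isomorphic
(`exists_iso_restriction`). So restriction is also essentially surjective, and colimit extension
becomes a functor by transport along these isomorphisms.
-/

noncomputable section

namespace ColimExt

/-! ### Finitely presented modules are dense -/

/-- A colimit of finitely presented modules over a finite category is finitely presented: it is the
quotient of the product of the modules by the relations coming from the arrows. -/
theorem finitePresentation_of_isColimit {R : Type u} [Ring R] {J : Type u} [SmallCategory J]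
    [Finite (Arrow J)] {F : J ⥤ ModuleCat.{u} R} {c : Cocone F} (hc : IsColimit c)
    (h : ∀ j, Module.FinitePresentation R (F.obj j)) : Module.FinitePresentation R c.pt := by
  classical
  have : Finite J := Finite.of_injective (fun j : J => Arrow.mk (𝟙 j)) fun _ _ e =>
    congrArg Arrow.leftFunc.obj e
  have := Fintype.ofFinite J
  let s : (∀ j, F.obj j) →ₗ[R] c.pt := LinearMap.lsum R (fun j => F.obj j) ℕ fun j => (c.ι.app j).hom
  have s_single (j : J) (x : F.obj j) : s (LinearMap.single R (fun j => F.obj j) j x) =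
      (c.ι.app j).hom x := LinearMap.lsum_piSingle ..
  let rel (a : Arrow J) : F.obj a.left →ₗ[R] ∀ j, F.obj j :=
    LinearMap.single R (fun j => F.obj j) a.left -
      LinearMap.single R (fun j => F.obj j) a.right ∘ₗ (F.map a.hom).hom
  let K : Submodule R (∀ j, F.obj j) := ⨆ a, LinearMap.range (rel a)
  let d : Cocone F :=
    { pt := ModuleCat.of R ((∀ j, F.obj j) ⧸ K)
      ι :=
        { app := fun j => ModuleCat.ofHom (K.mkQ ∘ₗ LinearMap.single R (fun j => F.obj j) j)
          naturality := fun i j a => by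
            ext x
            refine ((Submodule.Quotient.eq K).2 ?_).symm
            exact le_iSup (fun a => LinearMap.range (rel a)) (Arrow.mk a) ⟨x, rfl⟩ } }
  have fac : (hc.desc d).hom ∘ₗ s = K.mkQ := by
    refine LinearMap.pi_ext' fun j => LinearMap.ext fun x => ?_
    change (hc.desc d).hom (s (LinearMap.single R (fun j => F.obj j) j x)) = _
    rw [s_single]
    exact congrArg (fun f => f.hom x) (hc.fac d j)
  have surj : Function.Surjective s := by
    rw [← LinearMap.range_eq_top, ← Submodule.ker_mkQ (LinearMap.range s), LinearMap.ker_eq_top]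
    refine congrArg ModuleCat.Hom.hom
      (hc.hom_ext (f := ModuleCat.ofHom (LinearMap.range s).mkQ)
        (f' := ModuleCat.ofHom 0) fun j => ?_)
    ext x
    refine (Submodule.Quotient.mk_eq_zero _).2 ⟨LinearMap.single R (fun j => F.obj j) j x, ?_⟩
    exact s_single j x
  have ker : LinearMap.ker s = K := by
    refine le_antisymm (fun x hx => ?_) (iSup_le ?_)
    · rw [← Submodule.ker_mkQ K, ← fac]
      simp [LinearMap.mem_ker.1 hx]
    · rintro a _ ⟨x, rfl⟩
      change s (LinearMap.single R (fun j => F.obj j) a.left x -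
        LinearMap.single R (fun j => F.obj j) a.right ((F.map a.hom).hom x)) = 0
      rw [map_sub, s_single, s_single, ← c.w a.hom]
      exact sub_self _
  refine Module.finitePresentation_of_surjective s surj ?_
  rw [ker]
  exact Submodule.fg_iSup _ fun a => Module.Finite.iff_fg.1 (Module.Finite.range (rel a))

/-- The ring itself is a strong generator of the category of modules. -/
theorem isStrongGenerator_singleton_self (R : Type u) [Ring R] :
    (ObjectProperty.singleton (ModuleCat.of R R)).IsStrongGenerator := by
  rw [ObjectProperty.isStrongGenerator_iff]
  refine ⟨fun X Y f g h => ?_, fun X Y i _ h => ?_⟩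
  · ext x
    simpa using congrArg (fun f => f.hom (1 : R)) (h _ ((ObjectProperty.singleton_iff _ _).2 rfl)
      (ModuleCat.ofHom (LinearMap.toSpanSingleton R X x)))
  · have : Epi i := by
      rw [ModuleCat.epi_iff_surjective]
      intro y
      obtain ⟨f, hf⟩ := h _ ((ObjectProperty.singleton_iff _ _).2 rfl)
        (ModuleCat.ofHom (LinearMap.toSpanSingleton R Y y))
      refine ⟨f.hom (1 : R), ?_⟩
      simpa using congrArg (fun f => f.hom (1 : R)) hf
    exact isIso_of_mono_of_epi i

attribute [local instance] Cardinal.fact_isRegular_aleph0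

/-- The ring itself is a finitely presentable object, because it represents the forgetful
functor. -/
theorem singleton_self_le_isCardinalPresentable (R : Type u) [Ring R] :
    ObjectProperty.singleton (ModuleCat.of R R) ≤
      isCardinalPresentable (ModuleCat.{u} R) Cardinal.aleph0.{u} := by
  rw [ObjectProperty.singleton_le_iff]
  refine isFinitelyPresentable_iff_preservesFilteredColimits.2 ?_
  let e : forget (ModuleCat.{u} R) ≅ coyoneda.obj (Opposite.op (ModuleCat.of R R)) :=
    NatIso.ofComponents
      (fun X => Equiv.toIso ((LinearMap.ringLmapEquivSelf R ℕ X).symm.toEquiv.trans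
        (ModuleCat.homEquiv (M := ModuleCat.of R R) (N := X)).symm))
      (fun {X Y} f => by
        ext x
        apply ModuleCat.hom_ext
        apply LinearMap.ext_ring
        exact (f.hom.map_smul (1 : R) x).symm)
  exact ⟨fun J _ _ => preservesColimitsOfShape_of_natIso e⟩

variable (Λ : Type u) [Ring Λ]

/-- Finitely presented modules are the closure of the ring under finite colimits. -/
theorem isFP_eq_colimitsCardinalClosure : isFP Λ =
    (ObjectProperty.singleton (ModuleCat.of Λᵐᵒᵖ Λᵐᵒᵖ)).colimitsCardinalClosure
      Cardinal.aleph0.{u} := by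
  have : (isFP Λ).IsClosedUnderIsomorphisms :=
    ⟨fun {X Y} e (_ : Module.FinitePresentation Λᵐᵒᵖ X) =>
      Module.FinitePresentation.of_equiv e.toLinearEquiv⟩
  refine le_antisymm (fun X hX => ?_) (ObjectProperty.colimitsCardinalClosure_le _ _
    (fun J _ hJ => ⟨fun X ⟨p⟩ => ?_⟩) ?_)
  -- a finitely presented module is the cokernel of a map of finite free modules
  · have : Module.FinitePresentation Λᵐᵒᵖ X := hX
    obtain ⟨n, m, f, g, hf, hfg⟩ := Module.FinitePresentation.exists_fin' Λᵐᵒᵖ X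
    let P := (ObjectProperty.singleton (ModuleCat.of Λᵐᵒᵖ Λᵐᵒᵖ)).colimitsCardinalClosure
      Cardinal.aleph0.{u}
    have free (k : ℕ) : P (ModuleCat.of Λᵐᵒᵖ (Fin k → Λᵐᵒᵖ)) := by
      have := ObjectProperty.isClosedUnderColimitsOfShape_colimitsCardinalClosure
        (ObjectProperty.singleton (ModuleCat.of Λᵐᵒᵖ Λᵐᵒᵖ)) Cardinal.aleph0.{u}
        (Discrete (Fin k)) (by
          simp only [hasCardinalLT_aleph0_iff]
          infer_instance)
      refine P.prop_of_iso (ModuleCat.biproductIsoPi fun _ => ModuleCat.of Λᵐᵒᵖ Λᵐᵒᵖ) ?_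
      exact P.prop_of_isColimit (biproduct.isColimit _) fun _ =>
        ObjectProperty.le_colimitsCardinalClosure _ _ _ ((ObjectProperty.singleton_iff _ _).2 rfl)
    have := ObjectProperty.isClosedUnderColimitsOfShape_colimitsCardinalClosure
      (ObjectProperty.singleton (ModuleCat.of Λᵐᵒᵖ Λᵐᵒᵖ)) Cardinal.aleph0.{u}
      WalkingParallelPair (by
        simp only [hasCardinalLT_aleph0_iff]
        infer_instance)
    exact P.prop_of_isColimit
      (ModuleCat.isColimitCokernelCofork (ModuleCat.ofHom g) (ModuleCat.ofHom f) hfg hf) (by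
        rintro (_ | _)
        · exact free m
        · exact free n)
  · have : Finite (Arrow J) := (hasCardinalLT_aleph0_iff _).1 hJ
    exact finitePresentation_of_isColimit p.isColimit p.prop_diag_obj
  · rw [ObjectProperty.singleton_le_iff]
    exact inferInstanceAs (Module.FinitePresentation Λᵐᵒᵖ Λᵐᵒᵖ)

instance essentiallySmall_isFP : ObjectProperty.EssentiallySmall.{u} (isFP Λ) := by
  rw [isFP_eq_colimitsCardinalClosure]
  infer_instance

/-- Every module is the canonical colimit of the finitely presented modules mapping to it. -/
instance isDense_fpIncl : (fpIncl Λ).IsDense := by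
  have := (isStrongGenerator_singleton_self Λᵐᵒᵖ).isDense_colimitsCardinalClosure_ι
    (singleton_self_le_isCardinalPresentable Λᵐᵒᵖ)
  rwa [← isFP_eq_colimitsCardinalClosure] at this

/-- The canonical colimit of finitely presented modules is filtered. -/
instance isFiltered_costructuredArrow_fpIncl (X : ModuleCat.{u} Λᵐᵒᵖ) :
    IsFiltered (CostructuredArrow (fpIncl Λ) X) := by
  have := ObjectProperty.isFiltered_costructuredArrow_colimitsCardinalClosure_ι
    (ObjectProperty.singleton (ModuleCat.of Λᵐᵒᵖ Λᵐᵒᵖ)) Cardinal.aleph0.{u} X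
  rwa [← isFP_eq_colimitsCardinalClosure] at this

variable {Λ}

/-! ### Restriction of functors to finitely presented modules -/

/-- A functor which commutes with filtered colimits is the left Kan extension of its restriction
to finitely presented modules. -/
theorem isLeftKanExtension_of_preservesFilteredColimits
    (G : ModuleCat.{u} Λᵐᵒᵖ ⥤ AddCommGrpCat.{u}) [PreservesFilteredColimitsOfSize.{u, u} G] :
    G.IsLeftKanExtension (𝟙 (fpIncl Λ ⋙ G)) := by
  refine Functor.LeftExtension.IsPointwiseLeftKanExtension.isLeftKanExtension
    (E := Functor.LeftExtension.mk G (𝟙 (fpIncl Λ ⋙ G))) fun X => ?_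
  -- the indexing category lives in a larger universe, but is equivalent to a small one
  let e := equivSmallModel.{u} (CostructuredArrow (fpIncl Λ) X)
  have := IsFiltered.of_equivalence e
  have := preservesColimitsOfShape_of_equiv e.symm G
  exact IsColimit.ofIsoColimit (isColimitOfPreserves G ((fpIncl Λ).denseAt X))
    (Cocone.ext (Iso.refl _))

/-- Natural transformations between functors which commute with filtered colimits are the same as
natural transformations between their restrictions. -/
theorem bijective_whiskerLeft_fpIncl (G H : ModuleCat.{u} Λᵐᵒᵖ ⥤ AddCommGrpCat.{u})
    [PreservesFilteredColimitsOfSize.{u, u} G] :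
    Function.Bijective (Functor.whiskerLeft (fpIncl Λ) : (G ⟶ H) → _) := by
  have := isLeftKanExtension_of_preservesFilteredColimits G
  convert (G.homEquivOfIsLeftKanExtension (𝟙 (fpIncl Λ ⋙ G)) H).bijective using 1
  ext α : 1
  exact (Category.id_comp _).symm

instance full_restriction : (restriction Λ).Full where
  map_surjective {G H} α := by
    have := G.property.2
    obtain ⟨β, hβ⟩ := (bijective_whiskerLeft_fpIncl G.obj H.obj).2 α.hom
    exact ⟨ObjectProperty.homMk β, by ext1; exact hβ⟩

instance faithful_restriction : (restriction Λ).Faithful where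
  map_injective {G H} α β h := by
    have := G.property.2
    ext1
    exact (bijective_whiskerLeft_fpIncl G.obj H.obj).1 (congrArg (fun γ => γ.hom) h)

/-! ### Tensor products commute with colimits -/

theorem Tens.mk_add {A M : Type u} [AddCommGroup A] [Module Λᵐᵒᵖ A] [AddCommGroup M] [Module Λ M]
    (a : A) (m n : M) : (Tens.mk a (m + n) : Tens Λ A M) = Tens.mk a m + Tens.mk a n := by
  rw [Tens.mk, TensorProduct.tmul_add, map_add]
  rfl

theorem Tens.smul_mk {A M : Type u} [AddCommGroup A] [Module Λᵐᵒᵖ A] [AddCommGroup M] [Module Λ M]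
    (r : Λ) (a : A) (m : M) :
    (Tens.mk (MulOpposite.op r • a) m : Tens Λ A M) = Tens.mk a (r • m) := by
  rw [← sub_eq_zero]
  exact (QuotientAddGroup.eq_zero_iff _).2 (AddSubgroup.subset_closure ⟨a, r, m, rfl⟩)

/-- The homomorphism on `A ⊗_Λ M` induced by a balanced biadditive map. -/
def Tens.lift {A M X : Type u} [AddCommGroup A] [Module Λᵐᵒᵖ A] [AddCommGroup M] [Module Λ M]
    [AddCommGroup X] (φ : A →+ M →+ X)
    (h : ∀ (a : A) (r : Λ) (m : M), φ (MulOpposite.op r • a) m = φ a (r • m)) :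
    Tens Λ A M →+ X :=
  QuotientAddGroup.lift _ (TensorProduct.liftAddHom φ fun r a m => by simp) <| by
    rw [balancing, AddSubgroup.closure_le]
    rintro _ ⟨a, r, m, rfl⟩
    exact (map_sub _ _ _).trans (sub_eq_zero.2 (h a r m))

/-- The right `Λ`-module of additive maps from a left `Λ`-module `M` to an abelian group, with
`(φ * r) m = φ (r * m)`. -/
def homModule (M : ModuleCat.{u} Λ) (B : AddCommGrpCat.{u}) : ModuleCat.{u} Λᵐᵒᵖ :=
  letI : Module Λᵐᵒᵖ (M →+ B) := inferInstanceAs (Module Λᵈᵐᵃ (M →+ B))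
  ModuleCat.of Λᵐᵒᵖ (M →+ B)

/-- The functor `Hom_ℤ(M, -)`, right adjoint to `- ⊗_Λ M`. -/
def homFunctor (M : ModuleCat.{u} Λ) : AddCommGrpCat.{u} ⥤ ModuleCat.{u} Λᵐᵒᵖ where
  obj B := homModule M B
  map {B C} g := ModuleCat.ofHom (X := homModule M B) (Y := homModule M C)
    { toFun := fun φ : M →+ B => g.hom.comp φ
      map_add' := fun φ ψ => AddMonoidHom.comp_add g.hom φ ψ
      map_smul' := fun _ _ => rfl }

/-- The adjunction between `- ⊗_Λ M` and `Hom_ℤ(M, -)`. -/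
def tensorHomAdjunction (M : ModuleCat.{u} Λ) : tensorFunctor M ⊣ homFunctor M :=
  Adjunction.mkOfHomEquiv
    { homEquiv := fun A B =>
        { toFun := fun f => ModuleCat.ofHom (Y := homModule M B)
            { toFun := fun a => (AddMonoidHom.mk' (fun m => f.hom (Tens.mk a m)) fun m n => by
                exact (congrArg f.hom (Tens.mk_add a m n)).trans (f.hom.map_add _ _) : M →+ B)
              map_add' := fun a b => AddMonoidHom.ext fun m =>
                (congrArg f.hom (Tens.add_mk a b m)).trans (map_add f.hom _ _)
              map_smul' := fun r a => AddMonoidHom.ext fun m =>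
                congrArg f.hom (Tens.smul_mk r.unop a m) }
          invFun := fun g => AddCommGrpCat.ofHom
            (Tens.lift (g.hom.toAddMonoidHom : A →+ (M →+ B)) fun a r m =>
              DFunLike.congr_fun (F := M →+ B) (g.hom.map_smul (MulOpposite.op r) a) m)
          left_inv := fun f => AddCommGrpCat.hom_ext (Tens.hom_ext fun _ _ => rfl)
          right_inv := fun g => rfl }
      homEquiv_naturality_left_symm := fun _ _ =>
        AddCommGrpCat.hom_ext (Tens.hom_ext fun _ _ => rfl)
      homEquiv_naturality_right := fun _ _ => rfl }

instance preservesFilteredColimits_tensorFunctor (M : ModuleCat.{u} Λ) :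
    PreservesFilteredColimitsOfSize.{u, u} (tensorFunctor M) :=
  have := (tensorHomAdjunction M).leftAdjoint_preservesColimits
  PreservesColimits.preservesFilteredColimits _

/-! ### Kernels of natural transformations -/

section Kernels

variable {C : Type*} [Category* C]

/-- Two functors which embed in a third one with the same image are isomorphic, compatibly with the
embeddings. -/
theorem exists_iso_of_range_eq {P Q T : C ⥤ AddCommGrpCat.{u}} (i : P ⟶ T) (j : Q ⟶ T)
    (hi : ∀ X, Function.Injective (i.app X)) (hj : ∀ X, Function.Injective (j.app X))
    (h : ∀ X, Set.range (i.app X) = Set.range (j.app X)) : ∃ e : P ≅ Q, e.hom ≫ j = i := by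
  have h' (X : C) : (i.app X).hom.range = (j.app X).hom.range := SetLike.coe_injective (h X)
  let e (X : C) : P.obj X ≃+ Q.obj X :=
    ((AddMonoidHom.ofInjective (hi X)).trans (AddEquiv.addSubgroupCongr (h' X))).trans
      (AddMonoidHom.ofInjective (hj X)).symm
  have he (X : C) (x : P.obj X) : j.app X (e X x) = i.app X x :=
    congrArg Subtype.val ((AddMonoidHom.ofInjective (hj X)).apply_symm_apply _)
  refine ⟨NatIso.ofComponents (fun X => (e X).toAddCommGrpIso) fun {X Y} f => ?_, ?_⟩
  · ext x
    apply hj Y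
    change j.app Y (e Y (P.map f x)) = j.app Y (Q.map f (e X x))
    rw [he, NatTrans.naturality_apply, NatTrans.naturality_apply, he]
  · ext X x
    exact he X x

variable {T U : C ⥤ AddCommGrpCat.{u}} (α : T ⟶ U)

theorem injective_kernel_ι_app (X : C) : Function.Injective ((kernel.ι α).app X) :=
  (AddCommGrpCat.mono_iff_injective _).1 inferInstance

theorem exact_kernel_ι_app (X : C) :
    Function.Exact ((kernel.ι α).app X) (α.app X) := by
  have h := (ShortComplex.exact_kernel α).map ((evaluation C AddCommGrpCat.{u}).obj X)
  exact (ShortComplex.ab_exact_iff_function_exact _).1 h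

/-- A functor which embeds in an additive functor is additive. -/
theorem additive_of_injective {D : Type*} [Category* D] [Preadditive D]
    {P T : D ⥤ AddCommGrpCat.{u}} [T.Additive]
    (i : P ⟶ T) (hi : ∀ X, Function.Injective (i.app X)) : P.Additive where
  map_add {X Y f g} := by
    ext x
    apply hi Y
    change i.app Y (P.map (f + g) x) = i.app Y (P.map f x + P.map g x)
    simp only [map_add, NatTrans.naturality_apply, Functor.map_add, AddCommGrpCat.hom_add,
      AddMonoidHom.add_apply]

/-- A quotient of an additive functor is additive. -/
theorem additive_of_surjective {D : Type*} [Category* D] [Preadditive D]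
    {P T : D ⥤ AddCommGrpCat.{u}} [T.Additive]
    (p : T ⟶ P) (hp : ∀ X, Function.Surjective (p.app X)) : P.Additive where
  map_add {X Y f g} := by
    ext x
    obtain ⟨x, rfl⟩ := hp X x
    change P.map (f + g) (p.app X x) = P.map f (p.app X x) + P.map g (p.app X x)
    simp only [← NatTrans.naturality_apply, Functor.map_add, AddCommGrpCat.hom_add,
      AddMonoidHom.add_apply, map_add]

/-- The kernel of a natural transformation between functors which commute with filtered colimits
commutes with filtered colimits. -/
theorem preservesFilteredColimits_kernel [PreservesFilteredColimitsOfSize.{u, u} T]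
    [PreservesFilteredColimitsOfSize.{u, u} U] :
    PreservesFilteredColimitsOfSize.{u, u} (kernel α) where
  preserves_filtered_colimits J _ _ := ⟨fun {D} => ⟨fun {c} hc => by
    have := reflectsColimitsOfShape_of_reflectsIsomorphisms (J := J)
      (G := forget AddCommGrpCat.{u})
    have hT := isColimitOfPreserves (T ⋙ forget AddCommGrpCat) hc
    have hU := isColimitOfPreserves (U ⋙ forget AddCommGrpCat) hc
    refine ⟨isColimitOfReflects (forget AddCommGrpCat) ?_⟩
    refine Types.FilteredColimit.isColimitOf' _ _ (fun x => ?_) fun i x y hxy => ?_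
    · obtain ⟨i, y, hy : T.map (c.ι.app i) y = (kernel.ι α).app c.pt x⟩ :=
        Types.jointly_surjective_of_isColimit hT ((kernel.ι α).app c.pt x)
      -- `α y` need not vanish, but it does in the colimit, hence at a later stage
      have hαy : U.map (c.ι.app i) (α.app _ y) = U.map (c.ι.app i) 0 := by
        rw [← NatTrans.naturality_apply, hy, map_zero]
        exact (exact_kernel_ι_app α c.pt).apply_apply_eq_zero x
      obtain ⟨j, f, hf : U.map (D.map f) (α.app _ y) = U.map (D.map f) 0⟩ :=
        (Types.FilteredColimit.isColimit_eq_iff' hU _ _).1 hαy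
      rw [← NatTrans.naturality_apply, map_zero] at hf
      obtain ⟨z, hz⟩ := (exact_kernel_ι_app α _ _).1 hf
      refine ⟨j, z, injective_kernel_ι_app α c.pt ?_⟩
      change _ = (kernel.ι α).app c.pt ((kernel α).map (c.ι.app j) z)
      rw [NatTrans.naturality_apply, hz, ← ConcreteCategory.comp_apply, ← Functor.map_comp,
        c.w, hy]
    · have hxy' : T.map (c.ι.app i) ((kernel.ι α).app _ x) =
          T.map (c.ι.app i) ((kernel.ι α).app _ y) := by
        rw [← NatTrans.naturality_apply, ← NatTrans.naturality_apply]
        exact congrArg _ hxy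
      obtain ⟨j, f, hf : T.map (D.map f) ((kernel.ι α).app _ x) =
          T.map (D.map f) ((kernel.ι α).app _ y)⟩ :=
        (Types.FilteredColimit.isColimit_eq_iff' hT _ _).1 hxy'
      refine ⟨j, f, injective_kernel_ι_app α _ ?_⟩
      rw [← NatTrans.naturality_apply, ← NatTrans.naturality_apply] at hf
      exact hf⟩⟩

end Kernels

/-! ### Characters -/

/-- A character of an abelian group which vanishes on the kernel of a homomorphism factors through
that homomorphism, because `ℚ/ℤ` is injective. -/
theorem exists_character_comp_eq {B C : Type u} [AddCommGroup B] [AddCommGroup C] (α : B →+ C)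
    (χ : B →+ AddCircle (1 : ℚ)) (h : α.ker ≤ χ.ker) :
    ∃ ψ : C →+ AddCircle (1 : ℚ), ∀ b, ψ (α b) = χ b := by
  obtain ⟨ψ, hψ⟩ := CharacterModule.dual_surjective_of_injective
    (QuotientAddGroup.kerLift α).toIntLinearMap (QuotientAddGroup.kerLift_injective α)
    (QuotientAddGroup.lift α.ker χ h)
  exact ⟨ψ, fun b => DFunLike.congr_fun hψ (b : B ⧸ α.ker)⟩

/-- The left `Λ`-module `∏ i, Hom_ℤ(A i, ℚ/ℤ)` for a family `A` of right `Λ`-modules, with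
`(r * φ) a = φ (a * r)`. -/
def dualModule {I : Type u} (A : I → ModuleCat.{u} Λᵐᵒᵖ) : ModuleCat.{u} Λ :=
  letI (i : I) : Module Λ (A i →+ AddCircle (1 : ℚ)) :=
    Module.compHom (R := (Λᵐᵒᵖ)ᵈᵐᵃ) _ ((RingEquiv.opOp Λ).toRingHom : Λ →+* (Λᵐᵒᵖ)ᵈᵐᵃ)
  ModuleCat.of Λ (∀ i, A i →+ AddCircle (1 : ℚ))

/-- The functor `X ↦ ∏ i, Hom_ℤ(Hom_Λ(X, A i), ℚ/ℤ)`. -/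
def dualHomFunctor {I : Type u} (A : I → ModuleCat.{u} Λᵐᵒᵖ) :
    ModuleCat.{u} Λᵐᵒᵖ ⥤ AddCommGrpCat.{u} where
  obj X := AddCommGrpCat.of (∀ i, (X ⟶ A i) →+ AddCircle (1 : ℚ))
  map f := AddCommGrpCat.ofHom
    { toFun := fun ξ i => (ξ i).comp (Preadditive.leftComp (A i) f)
      map_zero' := rfl
      map_add' := fun _ _ => rfl }
  map_id X := by
    ext ξ i h
    exact congrArg (ξ i) (Category.id_comp h)
  map_comp f g := by
    ext ξ i h
    exact congrArg (ξ i) (Category.assoc f g h)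

/-- The pairing `x ⊗ φ ↦ (h ↦ φ (h x))` at a module `X`. -/
def pairingHom {I : Type u} (A : I → ModuleCat.{u} Λᵐᵒᵖ) (X : ModuleCat.{u} Λᵐᵒᵖ) :
    Tens Λ X (dualModule A) →+ ∀ i, (X ⟶ A i) →+ AddCircle (1 : ℚ) :=
  Tens.lift
    { toFun := fun x =>
        { toFun := fun (φ : ∀ i, A i →+ AddCircle (1 : ℚ)) i =>
            { toFun := fun h => φ i (h.hom x)
              map_zero' := map_zero _
              map_add' := fun _ _ => map_add _ _ _ }
          map_zero' := rfl
          map_add' := fun _ _ => rfl }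
      map_zero' := by
        ext φ i h
        exact (congrArg (φ i) (map_zero h.hom)).trans (map_zero _)
      map_add' := fun x y => by
        ext φ i h
        exact (congrArg (φ i) (map_add h.hom x y)).trans (map_add _ _ _) }
    fun x r φ => by
      ext i h
      exact congrArg (φ i) (map_smul h.hom (MulOpposite.op r) x)

/-- The natural transformation `x ⊗ φ ↦ (h ↦ φ (h x))`. -/
def pairing {I : Type u} (A : I → ModuleCat.{u} Λᵐᵒᵖ) :
    tensorFunctor (dualModule A) ⟶ dualHomFunctor A where
  app X := AddCommGrpCat.ofHom (pairingHom A X)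
  naturality _ _ _ := AddCommGrpCat.hom_ext (Tens.hom_ext fun _ _ => rfl)

/-- The element `x ⊗ m` as a biadditive function of `x` and `m`. -/
def Tens.mkHom (A M : Type u) [AddCommGroup A] [Module Λᵐᵒᵖ A] [AddCommGroup M] [Module Λ M] :
    A →+ M →+ Tens Λ A M :=
  AddMonoidHom.mk' (fun a => AddMonoidHom.mk' (Tens.mk a) (Tens.mk_add a)) fun a b =>
    AddMonoidHom.ext (Tens.add_mk a b)

theorem Tens.mkHom_apply {A M : Type u} [AddCommGroup A] [Module Λᵐᵒᵖ A] [AddCommGroup M]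
    [Module Λ M] (a : A) (m : M) : Tens.mkHom (Λ := Λ) A M a m = Tens.mk a m :=
  rfl

theorem Tens.smul_mkHom {A M : Type u} [AddCommGroup A] [Module Λᵐᵒᵖ A] [AddCommGroup M]
    [Module Λ M] (r : Λᵐᵒᵖ) (a : A) (m : M) :
    Tens.mkHom (Λ := Λ) A M (r • a) m = Tens.mkHom A M a (r.unop • m) :=
  Tens.smul_mk r.unop a m

theorem pairingHom_sum_mkHom {I : Type u} (A : I → ModuleCat.{u} Λᵐᵒᵖ)
    {X : ModuleCat.{u} Λᵐᵒᵖ} {n : ℕ} (x : Fin n → X)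
    (φ : Fin n → ∀ i, A i →+ AddCircle (1 : ℚ)) (i : I) (h : X ⟶ A i) :
    pairingHom A X (∑ k, Tens.mkHom X (dualModule A) (x k) (φ k)) i h =
      ∑ k, φ k i (h.hom (x k)) := by
  rw [map_sum, Finset.sum_apply, AddMonoidHom.finsetSum_apply]
  rfl

theorem apply_eq_sum_smul {R A : Type*} [Ring R] [AddCommGroup A] [Module R A] {n : ℕ}
    (f : (Fin n → R) →ₗ[R] A) (c : Fin n → R) : f c = ∑ k, c k • f (Pi.single k 1) := by
  conv_lhs => rw [← Finset.univ_sum_single c, map_sum]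
  refine Finset.sum_congr rfl fun k _ => ?_
  rw [← map_smul, ← Pi.single_smul, smul_eq_mul, mul_one]

/-- Every element of `A ⊗_Λ M` has the form `∑ k, x k ⊗ m k`, where the `x k` are given generators
of `A`. -/
theorem Tens.exists_eq_sum {A M : Type u} [AddCommGroup A] [Module Λᵐᵒᵖ A] [AddCommGroup M]
    [Module Λ M] {n : ℕ} (f : (Fin n → Λᵐᵒᵖ) →ₗ[Λᵐᵒᵖ] A) (hf : Function.Surjective f)
    (t : Tens Λ A M) :
    ∃ m : Fin n → M, t = ∑ k, Tens.mkHom A M (f (Pi.single k 1)) (m k) := by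
  let S : (Fin n → M) →+ Tens Λ A M :=
    ∑ k, (Tens.mkHom A M (f (Pi.single k 1))).comp (Pi.evalAddMonoidHom (fun _ => M) k)
  have hS (m : Fin n → M) : S m = ∑ k, Tens.mkHom A M (f (Pi.single k 1)) (m k) := by
    simp [S, AddMonoidHom.finsetSum_apply]
  -- the cokernel of `S` vanishes on the elements `a ⊗ m`
  have : QuotientAddGroup.mk' S.range = 0 := by
    refine Tens.hom_ext fun a m => ?_
    obtain ⟨c, rfl⟩ := hf a
    refine (QuotientAddGroup.eq_zero_iff _).2 ⟨fun k => (c k).unop • m, ?_⟩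
    rw [hS]
    simp_rw [← Tens.smul_mkHom, ← AddMonoidHom.finsetSum_apply, ← map_sum]
    rw [← apply_eq_sum_smul, Tens.mkHom_apply]
  obtain ⟨m, hm⟩ := (QuotientAddGroup.eq_zero_iff t).1 (DFunLike.congr_fun this t)
  exact ⟨m, by rw [← hm, hS]⟩

/-- The additive map `h ↦ (h (x k))_k`. -/
def evalAt {X A : ModuleCat.{u} Λᵐᵒᵖ} {n : ℕ} (x : Fin n → X) : (X ⟶ A) →+ (Fin n → A) where
  toFun h k := h.hom (x k)
  map_zero' := rfl
  map_add' _ _ := rfl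

/-- For finitely generated `X`, every character of `Hom_Λ(X, A i)` comes from `X ⊗_Λ -`: evaluation
at generators embeds `Hom_Λ(X, A i)` in a power of `A i`, and characters extend along it. -/
theorem surjective_pairing_app {I : Type u} (A : I → ModuleCat.{u} Λᵐᵒᵖ)
    (X : ModuleCat.{u} Λᵐᵒᵖ) [Module.Finite Λᵐᵒᵖ X] :
    Function.Surjective ((pairing A).app X) := by
  intro ξ
  obtain ⟨n, x, hx⟩ := Module.Finite.exists_fin (R := Λᵐᵒᵖ) (M := X)
  have key (i : I) : ∃ χ : (Fin n → A i) →+ AddCircle (1 : ℚ),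
      ∀ h : X ⟶ A i, χ (evalAt x h) = ξ i h := by
    refine exists_character_comp_eq (evalAt x) (ξ i) fun h hh => ?_
    have : h = 0 := by
      refine ModuleCat.hom_ext (LinearMap.ext_on_range hx fun k => ?_)
      exact congrFun hh k
    rw [this]
    exact zero_mem _
  choose χ hχ using key
  refine ⟨∑ k, Tens.mkHom X (dualModule A) (x k)
    fun i => (χ i).comp (AddMonoidHom.single (fun _ => A i) k), ?_⟩
  refine funext fun i => AddMonoidHom.ext fun h => (pairingHom_sum_mkHom A x _ i h).trans ?_
  rw [← hχ, ← Finset.univ_sum_single (evalAt x h), map_sum]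
  rfl

/-- For finitely presented `X`, the pairing is nondegenerate on `X ⊗_Λ ∏ i, Hom_ℤ(A i, ℚ/ℤ)`:
if `X` has generators `x k` and relations `∑ k, r l k • x k = 0`, then `Hom_Λ(X, A i)` is the kernel
of `r : A i ^ n → A i ^ m`, so a character `φ` of `A i ^ n` which vanishes on it has the form
`ψ ∘ r`; hence `∑ k, x k ⊗ φ k = ∑ l, (∑ k, r l k • x k) ⊗ ψ l = 0`. -/
theorem injective_pairing_app {I : Type u} (A : I → ModuleCat.{u} Λᵐᵒᵖ)
    (X : ModuleCat.{u} Λᵐᵒᵖ) [Module.FinitePresentation Λᵐᵒᵖ X] :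
    Function.Injective ((pairing A).app X) := by
  refine (injective_iff_map_eq_zero (pairingHom A X)).2 fun t ht => ?_
  obtain ⟨n, m, f, g, hf, hfg⟩ := Module.FinitePresentation.exists_fin' Λᵐᵒᵖ X
  obtain ⟨φ, rfl⟩ := Tens.exists_eq_sum f hf t
  change Fin n → ∀ i, A i →+ AddCircle (1 : ℚ) at φ
  have key (i : I) : ∃ χ : (Fin m → A i) →+ AddCircle (1 : ℚ), ∀ a : Fin n → A i,
      χ (fun l => ∑ k, g (Pi.single l 1) k • a k) = ∑ k, φ k i (a k) := by
    let α : (Fin n → A i) →+ (Fin m → A i) :=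
      AddMonoidHom.mk' (fun a l => ∑ k, g (Pi.single l 1) k • a k) fun a b => by
        ext l
        simp [Finset.sum_add_distrib]
    let c : (Fin n → A i) →+ AddCircle (1 : ℚ) := AddMonoidHom.mk' (fun a => ∑ k, φ k i (a k))
      fun a b => by simp [Finset.sum_add_distrib]
    refine exists_character_comp_eq α c fun a ha => ?_
    let L : (Fin n → Λᵐᵒᵖ) →ₗ[Λᵐᵒᵖ] A i := Fintype.linearCombination Λᵐᵒᵖ a
    have hL : L ∘ₗ g = 0 := by
      refine LinearMap.pi_ext' fun l => LinearMap.ext_ring ?_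
      exact congrFun ha l
    obtain ⟨h, hh⟩ : ∃ h : X →ₗ[Λᵐᵒᵖ] A i, h ∘ₗ f = L := by
      have hker : LinearMap.ker f ≤ LinearMap.ker L := by
        rw [LinearMap.exact_iff.1 hfg]
        rintro _ ⟨y, rfl⟩
        exact LinearMap.congr_fun hL y
      refine ⟨(LinearMap.ker f).liftQ L hker ∘ₗ
        (f.quotKerEquivOfSurjective hf).symm.toLinearMap, LinearMap.ext fun y => ?_⟩
      have hy : (f.quotKerEquivOfSurjective hf).symm (f y) = Submodule.Quotient.mk y :=
        (LinearEquiv.symm_apply_eq _).2 rfl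
      exact congrArg ((LinearMap.ker f).liftQ L hker) hy
    change ∑ k, φ k i (a k) = 0
    refine Eq.trans ?_ ((pairingHom_sum_mkHom A _ φ i (ModuleCat.ofHom h)).symm.trans
      (DFunLike.congr_fun (congrFun ht i) (ModuleCat.ofHom h)))
    refine Finset.sum_congr rfl fun k _ => congrArg (φ k i) ?_
    refine Eq.trans ?_ (LinearMap.congr_fun hh (Pi.single k 1)).symm
    simp [L]
  choose χ hχ using key
  let ψ (l : Fin m) : dualModule A := fun i => (χ i).comp (AddMonoidHom.single (fun _ => A i) l)
  have hφ (k : Fin n) : (φ k : dualModule A) = ∑ l, (g (Pi.single l 1) k).unop • ψ l := by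
    refine funext fun i => AddMonoidHom.ext fun b => ?_
    have lhs : ∑ j, φ j i ((Pi.single k b : Fin n → A i) j) = φ k i b := by
      rw [Finset.sum_eq_single k (fun j _ hj => by rw [Pi.single_eq_of_ne hj, map_zero])
        (fun h => (h (Finset.mem_univ k)).elim), Pi.single_eq_same]
    have rel (l : Fin m) : ∑ j, g (Pi.single l 1) j • (Pi.single k b : Fin n → A i) j =
        g (Pi.single l 1) k • b := by
      rw [Finset.sum_eq_single k (fun j _ hj => by rw [Pi.single_eq_of_ne hj, smul_zero])
        (fun h => (h (Finset.mem_univ k)).elim), Pi.single_eq_same]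
    rw [← lhs, ← hχ, funext rel, ← Finset.univ_sum_single fun l => g (Pi.single l 1) k • b, map_sum]
    have : (∑ l, (g (Pi.single l 1) k).unop • ψ l : dualModule A) =
      (fun j => ∑ l, ((g (Pi.single l 1) k).unop • ψ l : dualModule A) j :
        ∀ i, A i →+ AddCircle (1 : ℚ)) := funext fun j => Finset.sum_apply j _ _
    rw [this]
    exact (AddMonoidHom.finsetSum_apply
      (fun l => ((g (Pi.single l 1) k).unop • ψ l : dualModule A) i : Fin m → A i →+ _) _ b).symm
  simp_rw [hφ, map_sum, ← Tens.smul_mkHom]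
  rw [Finset.sum_comm]
  refine Finset.sum_eq_zero fun l _ => ?_
  rw [← AddMonoidHom.finsetSum_apply, ← map_sum, ← apply_eq_sum_smul,
    hfg.apply_apply_eq_zero, map_zero]
  rfl

/-! ### Injective copresentations -/

/-- On finitely presented modules, `- ⊗_Λ ∏ i, Hom_ℤ(A i, ℚ/ℤ)` is the functor
`∏ i, Hom_ℤ(Hom_Λ(-, A i), ℚ/ℤ)`. -/
def fpPairingIso {I : Type u} (A : I → ModuleCat.{u} Λᵐᵒᵖ) :
    fpIncl Λ ⋙ tensorFunctor (dualModule A) ≅ fpIncl Λ ⋙ dualHomFunctor A :=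
  have (X : FPMod Λ) : IsIso ((Functor.whiskerLeft (fpIncl Λ) (pairing A)).app X) := by
    have : Module.FinitePresentation Λᵐᵒᵖ X.obj := X.property
    exact (ConcreteCategory.isIso_iff_bijective _).2
      ⟨injective_pairing_app A X.obj, surjective_pairing_app A X.obj⟩
  have := NatIso.isIso_of_isIso_app (Functor.whiskerLeft (fpIncl Λ) (pairing A))
  asIso (Functor.whiskerLeft (fpIncl Λ) (pairing A))

/-- The natural transformation `x ↦ (h ↦ χ i (F h x))` defined by characters `χ i` of the groups
`F (A i)`. -/
def ofCharacters (F : SmallFunctorCat Λ) {I : Type u} (A : I → FPMod Λ)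
    (χ : ∀ i, F.obj.obj (A i) →+ AddCircle (1 : ℚ)) :
    F.obj ⟶ fpIncl Λ ⋙ dualHomFunctor fun i => (A i).obj where
  app X := AddCommGrpCat.ofHom
    { toFun := fun x i =>
        { toFun := fun h => χ i (F.obj.map (ObjectProperty.homMk h) x)
          map_zero' := by
            rw [show ObjectProperty.homMk (0 : X.obj ⟶ (A i).obj) = 0 from rfl, Functor.map_zero]
            exact map_zero _
          map_add' := fun h k => by
            rw [show ObjectProperty.homMk (h + k) =
              (ObjectProperty.homMk h + ObjectProperty.homMk k : X ⟶ A i) from rfl,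
              Functor.map_add]
            exact map_add _ _ _ }
      map_zero' := by
        refine funext fun i => AddMonoidHom.ext fun h => ?_
        exact (congrArg (χ i) (map_zero _)).trans (map_zero _)
      map_add' := fun x y => by
        refine funext fun i => AddMonoidHom.ext fun h => ?_
        exact (congrArg (χ i) (map_add _ x y)).trans (map_add _ _ _) }
  naturality X Y f := by
    ext x
    refine funext fun i => AddMonoidHom.ext fun h => congrArg (χ i) ?_
    exact (ConcreteCategory.congr_hom (F.obj.map_comp f (ObjectProperty.homMk h)) x).symm

/-- Every natural transformation to `∏ i, Hom_ℤ(Hom_Λ(-, A i), ℚ/ℤ)` is defined by characters: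
this is the Yoneda lemma. -/
theorem exists_eq_ofCharacters (F : SmallFunctorCat Λ) {I : Type u} (A : I → FPMod Λ)
    (φ : F.obj ⟶ fpIncl Λ ⋙ dualHomFunctor fun i => (A i).obj) :
    ∃ χ : ∀ i, F.obj.obj (A i) →+ AddCircle (1 : ℚ), φ = ofCharacters F A χ := by
  refine ⟨fun i =>
    { toFun := fun x => (φ.app (A i) x : ∀ j, ((A i).obj ⟶ (A j).obj) →+ AddCircle (1 : ℚ)) i (𝟙 _)
      map_zero' := by
        rw [map_zero]
        rfl
      map_add' := fun x y => by
        rw [map_add]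
        rfl }, ?_⟩
  ext X x
  refine funext fun i => AddMonoidHom.ext fun h => ?_
  have := DFunLike.congr_fun (congrFun (NatTrans.naturality_apply φ
    (ObjectProperty.homMk h : X ⟶ A i) x) i) (𝟙 _)
  refine Eq.trans ?_ this.symm
  exact congrArg ((φ.app X x : ∀ j, (X.obj ⟶ (A j).obj) →+ AddCircle (1 : ℚ)) i)
    (Category.comp_id h).symm

/-- Monomorphisms of additive functors are pointwise injective. -/
theorem injective_app_of_mono {F G : SmallFunctorCat Λ} (j : F ⟶ G) [Mono j] (X : FPMod Λ) :
    Function.Injective (j.hom.app X) := by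
  have hK : (kernel j.hom).Additive :=
    additive_of_injective (kernel.ι j.hom) (injective_kernel_ι_app j.hom)
  let i : AdditiveFunctor.of (kernel j.hom) ⟶ F := ObjectProperty.homMk (kernel.ι j.hom)
  have hi : i = ObjectProperty.homMk 0 := by
    rw [← cancel_mono j]
    ext1
    exact (kernel.condition j.hom).trans zero_comp.symm
  refine (injective_iff_map_eq_zero (j.hom.app X).hom).2 fun x hx => ?_
  obtain ⟨y, rfl⟩ := (exact_kernel_ι_app j.hom X x).1 hx
  exact congrArg (fun k => k.hom.app X y) hi

/-- The injective objects used for copresentations: extending a natural transformation along a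
monomorphism amounts to extending the corresponding characters. -/
theorem injective_fpTensor_dualModule {I : Type u} (A : I → FPMod Λ) :
    Injective (fpTensor (dualModule fun i => (A i).obj)) where
  factors {F G} φ j _ := by
    let e := fpPairingIso fun i => (A i).obj
    obtain ⟨χ, hχ⟩ := exists_eq_ofCharacters F A (φ.hom ≫ e.hom)
    have key (i : I) : ∃ ψ : G.obj.obj (A i) →+ AddCircle (1 : ℚ),
        ∀ x, ψ (j.hom.app (A i) x) = χ i x := by
      refine exists_character_comp_eq (j.hom.app (A i)).hom (χ i) ?_
      rw [(AddMonoidHom.ker_eq_bot_iff _).2 (injective_app_of_mono j (A i))]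
      exact bot_le
    choose ψ hψ using key
    refine ⟨ObjectProperty.homMk (ofCharacters G A ψ ≫ e.inv), ?_⟩
    ext1
    refine (Category.assoc _ _ _).symm.trans ((Iso.comp_inv_eq e).2 (Eq.trans ?_ hχ.symm))
    ext X x
    refine funext fun i => AddMonoidHom.ext fun h => Eq.trans ?_ (hψ i _)
    exact congrArg (ψ i) (NatTrans.naturality_apply j.hom (ObjectProperty.homMk h) x).symm

/-- Every additive functor on finitely presented modules embeds in an injective one of the form
`- ⊗_Λ M`. -/
theorem exists_embedding (F : SmallFunctorCat Λ) :
    ∃ (M : ModuleCat.{u} Λ) (ι : F.obj ⟶ fpIncl Λ ⋙ tensorFunctor M),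
      Injective (fpTensor M) ∧ ∀ X, Function.Injective (ι.app X) := by
  let e := equivSmallModel.{u} (FPMod Λ)
  -- all finitely presented modules up to isomorphism, each repeated once for every character
  let I := Σ S : SmallModel.{u} (FPMod Λ),
    F.obj.obj (e.inverse.obj S) →+ AddCircle (1 : ℚ)
  let A (i : I) : FPMod Λ := e.inverse.obj i.1
  let φ := ofCharacters F A fun i => i.2
  refine ⟨dualModule fun i => (A i).obj, φ ≫ (fpPairingIso _).inv,
    injective_fpTensor_dualModule A, fun X => ?_⟩
  have hφ : Function.Injective (φ.app X) := by
    refine (injective_iff_map_eq_zero (φ.app X).hom).2 fun x hx => ?_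
    let u := e.unitIso.app X
    have hu : F.obj.map u.hom x = 0 := CharacterModule.eq_zero_of_character_apply fun c =>
      DFunLike.congr_fun (congrFun hx ⟨e.functor.obj X, c⟩) u.hom.hom
    exact (ConcreteCategory.isIso_iff_bijective (F.obj.map u.hom)).1 inferInstance |>.1
      (hu.trans (map_zero _).symm)
  have hinv : Function.Injective ((fpPairingIso fun i => (A i).obj).inv.app X) :=
    ((ConcreteCategory.isIso_iff_bijective _).1 inferInstance).1
  exact hinv.comp hφ

/-- The canonical map `M → Λ ⊗_Λ M` is bijective. -/
theorem Tens.bijective_mk_one (M : Type u) [AddCommGroup M] [Module Λ M] :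
    Function.Bijective (Tens.mk (1 : Λᵐᵒᵖ) : M → Tens Λ Λᵐᵒᵖ M) := by
  let ψ : Tens Λ Λᵐᵒᵖ M →+ M := Tens.lift
    (AddMonoidHom.mk' (fun a => AddMonoidHom.mk' (fun m => a.unop • m) (smul_add a.unop))
      fun a b => AddMonoidHom.ext fun m => add_smul a.unop b.unop m)
    fun a r m => mul_smul a.unop r m
  refine Function.bijective_iff_has_inverse.2 ⟨ψ, fun m => one_smul Λ m, fun t => ?_⟩
  refine DFunLike.congr_fun (f := (Tens.mkHom Λᵐᵒᵖ M 1).comp ψ) (g := AddMonoidHom.id _)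
    (Tens.hom_ext fun a m => ?_) t
  refine (Tens.smul_mk a.unop (1 : Λᵐᵒᵖ) m).symm.trans ?_
  exact congrArg (fun b => Tens.mk b m) (mul_one a)

/-- Every natural transformation `- ⊗ M ⟶ - ⊗ N` on finitely presented modules has the form
`- ⊗ f`, where `f` is its component at the ring. -/
theorem exists_eq_tensorMap {M N : ModuleCat.{u} Λ}
    (φ : fpIncl Λ ⋙ tensorFunctor M ⟶ fpIncl Λ ⋙ tensorFunctor N) :
    ∃ f : M ⟶ N, φ = Functor.whiskerLeft (fpIncl Λ) (tensorMap f) := by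
  let R : FPMod Λ := ⟨ModuleCat.of Λᵐᵒᵖ Λᵐᵒᵖ,
    inferInstanceAs (Module.FinitePresentation Λᵐᵒᵖ Λᵐᵒᵖ)⟩
  let e := Equiv.ofBijective _ (Tens.bijective_mk_one (Λ := Λ) N)
  let φ₁ : Tens Λ Λᵐᵒᵖ M →+ Tens Λ Λᵐᵒᵖ N := (φ.app R).hom
  have he (m : M) : Tens.mk 1 (e.symm (φ₁ (Tens.mk 1 m))) = φ₁ (Tens.mk 1 m) :=
    e.apply_symm_apply _
  -- the component of `φ` at `X` is determined by naturality with respect to `1 ↦ x`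
  have nat (X : FPMod Λ) (x : X.obj) (m : M) :
      φ.app X (Tens.mk x m) = Tens.mk x (e.symm (φ₁ (Tens.mk 1 m))) := by
    have h := NatTrans.naturality_apply φ (X := R) (Y := X)
      (ObjectProperty.homMk (ModuleCat.ofHom (LinearMap.toSpanSingleton Λᵐᵒᵖ X.obj x)))
      (Tens.mk (1 : Λᵐᵒᵖ) m)
    have one (K : ModuleCat.{u} Λ) (k : K) :
      (Tens.mk (LinearMap.toSpanSingleton Λᵐᵒᵖ X.obj x 1) k : Tens Λ X.obj K) = Tens.mk x k := by
      rw [LinearMap.toSpanSingleton_apply, one_smul]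
    refine (congrArg (φ.app X) (one M m).symm).trans (h.trans ?_)
    exact (congrArg (Tens.map (LinearMap.toSpanSingleton Λᵐᵒᵖ X.obj x) LinearMap.id)
      (he m).symm).trans (one N _)
  refine ⟨ModuleCat.ofHom
    { toFun := fun m => e.symm (φ₁ (Tens.mk 1 m))
      map_add' := fun m n => (Equiv.symm_apply_eq _).2 ?_
      map_smul' := fun r m => (Equiv.symm_apply_eq _).2 ?_ }, ?_⟩
  · change φ₁ (Tens.mk 1 (m + n)) = Tens.mk 1 _
    rw [Tens.mk_add, Tens.mk_add, he, he]
    exact map_add φ₁ _ _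
  · change φ₁ (Tens.mk 1 (r • m)) = Tens.mk 1 (r • _)
    rw [← Tens.smul_mk, ← Tens.smul_mk]
    exact nat R _ m
  · ext X t
    exact DFunLike.congr_fun (f := (φ.app X).hom) (Tens.hom_ext fun x m => nat X x m) t

/-- A copresentation is obtained by embedding `F` and then the cokernel of that embedding. -/
theorem nonempty_injectiveCopresentation (F : SmallFunctorCat Λ) :
    Nonempty (InjectiveCopresentation F) := by
  obtain ⟨M, ι, hM, hι⟩ := exists_embedding F
  have hπ (X : FPMod Λ) : Function.Surjective ((cokernel.π ι).app X) :=
    (AddCommGrpCat.epi_iff_surjective _).1 inferInstance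
  have : (cokernel ι).Additive := additive_of_surjective (cokernel.π ι) hπ
  obtain ⟨N, κ, hN, hκ⟩ := exists_embedding (AdditiveFunctor.of (cokernel ι))
  obtain ⟨f, hf⟩ := exists_eq_tensorMap (cokernel.π ι ≫ κ)
  refine ⟨⟨M, N, hM, hN, ι, f, hι, fun X => ?_⟩⟩
  have hexact : Function.Exact (ι.app X) ((cokernel.π ι).app X) :=
    (ShortComplex.ab_exact_iff_function_exact _).1
      ((ShortComplex.exact_cokernel ι).map ((evaluation _ AddCommGrpCat.{u}).obj X))
  change Function.Exact (ι.app X) ((Functor.whiskerLeft (fpIncl Λ) (tensorMap f)).app X)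
  rw [← hf]
  exact fun y => ((map_eq_zero_iff (κ.app X).hom (hκ X)).trans (hexact y))

/-! ### Colimit extensions -/

namespace InjectiveCopresentation

variable {F : SmallFunctorCat Λ} (c : InjectiveCopresentation F)

theorem isFinitary_colimitExtension : isFinitary Λ c.colimitExtension :=
  ⟨additive_of_injective c.incl (injective_kernel_ι_app _), preservesFilteredColimits_kernel _⟩

/-- The restriction of a colimit extension of `F` is `F`, as a subfunctor of `- ⊗ M`. -/
theorem exists_iso_restriction :
    ∃ e : F.obj ≅ fpIncl Λ ⋙ c.colimitExtension,
      e.hom ≫ Functor.whiskerLeft (fpIncl Λ) c.incl = c.ι :=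
  exists_iso_of_range_eq _ _ c.injective_ι (fun X => injective_kernel_ι_app _ X.obj) fun X =>
    Set.ext fun y => (c.exact X y).symm.trans (exact_kernel_ι_app (tensorMap c.f) X.obj y)

end InjectiveCopresentation

/-- Functors which commute with filtered colimits are isomorphic if their restrictions to finitely
presented modules are. -/
theorem nonempty_iso_of_restriction (G H : ModuleCat.{u} Λᵐᵒᵖ ⥤ AddCommGrpCat.{u})
    [PreservesFilteredColimitsOfSize.{u, u} G] [PreservesFilteredColimitsOfSize.{u, u} H]
    (e : fpIncl Λ ⋙ G ≅ fpIncl Λ ⋙ H) : Nonempty (G ≅ H) := by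
  obtain ⟨f, hf⟩ := (bijective_whiskerLeft_fpIncl G H).2 e.hom
  obtain ⟨g, hg⟩ := (bijective_whiskerLeft_fpIncl H G).2 e.inv
  refine ⟨⟨f, g, (bijective_whiskerLeft_fpIncl G G).1 ?_,
    (bijective_whiskerLeft_fpIncl H H).1 ?_⟩⟩
  · rw [Functor.whiskerLeft_comp, hf, hg, e.hom_inv_id]
    rfl
  · rw [Functor.whiskerLeft_comp, hf, hg, e.inv_hom_id]
    rfl

end ColimExt

end

theorem theoremT (Λ : Type u) [Ring Λ] :
    -- every additive functor on finitely presented modules has a colimit extension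
    (∀ F : ColimExt.SmallFunctorCat Λ, Nonempty (ColimExt.InjectiveCopresentation F)) ∧
    -- a colimit extension of `F` is additive, commutes with filtered colimits and restricts to `F`,
    -- and any functor which commutes with filtered colimits and restricts to `F` is isomorphic to it
    (∀ (F : ColimExt.SmallFunctorCat Λ) (c : ColimExt.InjectiveCopresentation F),
      c.colimitExtension.Additive ∧
      PreservesFilteredColimitsOfSize.{u, u} c.colimitExtension ∧
      Nonempty (ColimExt.fpIncl Λ ⋙ c.colimitExtension ≅ F.obj) ∧
      ∀ G : ModuleCat.{u} Λᵐᵒᵖ ⥤ AddCommGrpCat.{u},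
        PreservesFilteredColimitsOfSize.{u, u} G →
        Nonempty (ColimExt.fpIncl Λ ⋙ G ≅ F.obj) →
        Nonempty (G ≅ c.colimitExtension)) ∧
    -- whatever copresentations are chosen, colimit extension is an equivalence, with
    -- restriction as quasi-inverse; the unit is the canonical identification of `F` with the
    -- restriction of its colimit extension, as subfunctors of `- ⊗ M`
    (∀ c : ∀ F : ColimExt.SmallFunctorCat Λ, ColimExt.InjectiveCopresentation F,
      ∃ (E : ColimExt.SmallFunctorCat Λ ⥤ ColimExt.FinitaryFunctorCat Λ)
        (i : ∀ F, (E.obj F).obj ≅ (c F).colimitExtension)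
        (η : 𝟭 (ColimExt.SmallFunctorCat Λ) ≅ E ⋙ ColimExt.restriction Λ)
        (_ : ColimExt.restriction Λ ⋙ E ≅ 𝟭 (ColimExt.FinitaryFunctorCat Λ)),
        ∀ F : ColimExt.SmallFunctorCat Λ,
          (η.hom.app F).hom ≫
            Functor.whiskerLeft (ColimExt.fpIncl Λ) ((i F).hom ≫ (c F).incl) = (c F).ι) := by
  refine ⟨ColimExt.nonempty_injectiveCopresentation, fun F c => ?_, fun c => ?_⟩
  · obtain ⟨e, -⟩ := c.exists_iso_restriction
    have := c.isFinitary_colimitExtension.2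
    exact ⟨c.isFinitary_colimitExtension.1, this, ⟨e.symm⟩, fun G _ ⟨e'⟩ =>
      ColimExt.nonempty_iso_of_restriction _ _ (e' ≪≫ e)⟩
  · choose e he using fun F => (c F).exists_iso_restriction
    let R := ColimExt.restriction Λ
    let obj (F : ColimExt.SmallFunctorCat Λ) : ColimExt.FinitaryFunctorCat Λ :=
      ⟨(c F).colimitExtension, (c F).isFinitary_colimitExtension⟩
    let e' (F : ColimExt.SmallFunctorCat Λ) : F ≅ R.obj (obj F) := ObjectProperty.isoMk _ (e F)
    -- restriction is fully faithful, so that `E` is determined on morphisms by naturality of `e'`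
    let E : ColimExt.SmallFunctorCat Λ ⥤ ColimExt.FinitaryFunctorCat Λ :=
      { obj := obj
        map := fun {F G} φ => R.preimage ((e' F).inv ≫ φ ≫ (e' G).hom)
        map_id := fun F => R.map_injective (by simp)
        map_comp := fun φ ψ => R.map_injective (by simp) }
    refine ⟨E, fun F => Iso.refl _, NatIso.ofComponents e' fun {F G} φ => ?_,
      NatIso.ofComponents (fun G => R.preimageIso (e' (R.obj G)).symm) fun {G H} φ =>
        R.map_injective ?_, fun F => ?_⟩
    · simp [E, R]
    · simp [E, R]
    · exact he F
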